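/- Let $\mathbb{D}$ be the open unit disc, $\mathbb{T}$ the unit circle and $m$ the normalized Lebesgue measure on $\mathbb{T}$. A closed set $E\subseteq\mathbb{T}$ is a Beurling–Carleson set if $\sum_k |A_k|\log(1/|A_k|)<\infty$, where $\mathbb{T}\setminus E=\bigcup_k A_k$ is the decomposition into disjoint open arcs and $|A_k|$ is the length of $A_k$. For such a set $E$ with $m(E)>0$, let $a_k,b_k$ be the endpoints of $A_k$, and put $\phi_E(\zeta)=|(\zeta-a_k)(\zeta-b_k)|$ for $\zeta\in A_k$ and $\phi_E(\zeta)=1$ for $\zeta\in E$. (i) For every Beurling–Carleson set $E$ with $m(E)>0$ we have $\log\phi_E\in L^1(\mathbb{T},m)$. (ii) For every integer $n\ge 0$ there is $N_0=N_0(n)$ such that the following holds for every integer $N\ge N_0$, every Beurling–Carleson set $E$ with $m(E)>0$ and all finite positive Borel measures $\nu_1,\nu_2$ concentrated on $E$. Let $$s(z)=\exp\Big(\int_{\mathbb{T}}\frac{\zeta+z}{\zeta-z}\log\big(\phi_E(\zeta)^N\big)\,dm(\zeta)\Big),\qquad g_l(z)=\exp\Big(-\int_E\frac{\zeta+z}{\zeta-z}\,d\nu_l(\zeta)\Big),\qquad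 z\in\mathbb{D},\ l=1,2,$$ so that $s$ is the outer function with boundary modulus $\phi_E^N$. Then $g_1$, $g_2$ and $s$ have limits from within $\mathbb{D}$ at every point of $\mathbb{T}\setminus E$, and, with these boundary values, the $2\pi$-periodic function $$F(t)=\overline{g_1(e^{it})}\,g_2(e^{it})\,s(e^{it})\,1_{\mathbb{T}\setminus E}(e^{it})$$ (equal to $0$ when $e^{it}\in E$) belongs to $C^n(\mathbb{R})$. -/

import Mathlib

open Complex MeasureTheory Set Filter Topology

namespace BeurlingCarleson

/-- Normalized Lebesgue measure `m` on the unit circle `𝕋 = {z : ℂ | ‖z‖ = 1}`, as a (probability)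
measure on `ℂ`: the image of `dt / 2π` on `(-π, π]` under `t ↦ e^{it}`. -/
noncomputable def circleMeasure : Measure ℂ :=
  (ENNReal.ofReal (2 * Real.pi))⁻¹ •
    Measure.map (fun t : ℝ => exp (t * I)) (volume.restrict (Ioc (-Real.pi) Real.pi))

/-- The open circular arc `{e^{it} : p.1 < t < p.2}`. -/
def openArc (p : ℝ × ℝ) : Set ℂ := (fun t : ℝ => exp (t * I)) '' Ioo p.1 p.2

/-- The arcs complementary to a closed nonempty set `E ⊆ 𝕋`, i.e. the connected components of
`𝕋 \ E`, as pairs of angles `(α, β)`: the open arc from `e^{iα}` to `e^{iβ}` misses `E` and both its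
endpoints are in `E`.  The normalization `0 ≤ α < 2π` makes every arc occur exactly once; the
length of the arc is `β - α`. -/
def complementaryArcs (E : Set ℂ) : Set (ℝ × ℝ) :=
  {p | 0 ≤ p.1 ∧ p.1 < 2 * Real.pi ∧ p.1 < p.2 ∧ p.2 ≤ p.1 + 2 * Real.pi ∧
    Disjoint (openArc p) E ∧ exp (p.1 * I) ∈ E ∧ exp (p.2 * I) ∈ E}

/-- `E` is a Beurling–Carleson set: a closed subset of the unit circle whose complementary arcs
`A_k` satisfy `∑ₖ |A_k| log (1 / |A_k|) < ∞`.  (At most six terms are negative, so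
convergence of the series is the same as summability.) -/
def IsBeurlingCarleson (E : Set ℂ) : Prop :=
  IsClosed E ∧ E ⊆ Metric.sphere 0 1 ∧
    Summable fun p : complementaryArcs E =>
      (p.1.2 - p.1.1) * Real.log (1 / (p.1.2 - p.1.1))

open scoped Classical in
/-- `φ(ζ) = |(ζ - a)(ζ - b)|` if `ζ` lies in the complementary arc of `E` with endpoints `a`, `b`
(the arc containing `ζ` is unique), and `φ(ζ) = 1` otherwise, in particular on `E`. -/
noncomputable def phi (E : Set ℂ) (ζ : ℂ) : ℝ :=
  if h : ∃ p ∈ complementaryArcs E, ζ ∈ openArc p then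
    ‖(ζ - exp (h.choose.1 * I)) * (ζ - exp (h.choose.2 * I))‖
  else 1

/-- The outer function on the unit disc with boundary modulus `k` (for `log k ∈ L¹(m)`). -/
noncomputable def outerFunction (k : ℂ → ℝ) (z : ℂ) : ℂ :=
  exp (∫ ζ, (ζ + z) / (ζ - z) * (Real.log (k ζ) : ℂ) ∂circleMeasure)

/-- `z ↦ exp (-∫_E (ζ + z) / (ζ - z) dν(ζ))` on the unit disc. -/
noncomputable def singularExp (E : Set ℂ) (ν : Measure ℂ) (z : ℂ) : ℂ :=
  exp (-∫ ζ in E, (ζ + z) / (ζ - z) ∂ν)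

/-- The boundary value at `ζ ∈ 𝕋` of a function on the unit disc: its limit at `ζ` from within the
disc.  It is meaningful only where this limit exists. -/
noncomputable def boundaryValue (f : ℂ → ℂ) (ζ : ℂ) : ℂ :=
  limUnder (𝓝[Metric.ball 0 1] ζ) f

/-- The limit of `f` at `ζ` from within the unit disc exists. -/
def HasBoundaryValue (f : ℂ → ℂ) (ζ : ℂ) : Prop :=
  ∃ w, Tendsto f (𝓝[Metric.ball 0 1] ζ) (𝓝 w)

/-- The function `conj(g₁) g₂ s 1_{𝕋 \ E}` on the circle, formed with boundary values. -/
noncomputable def cutoff (E : Set ℂ) (g₁ g₂ s : ℂ → ℂ) : ℂ → ℂ :=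
  (Metric.sphere 0 1 \ E).indicator fun ζ =>
    (starRingEnd ℂ) (boundaryValue g₁ ζ) * boundaryValue g₂ ζ * boundaryValue s ζ

end BeurlingCarleson

/-!
On an arc `A` of length `ℓ` with endpoints `a`, `b` the integral of `|log |(ζ - a)(ζ - b)||` is
`O(ℓ log (1 / ℓ) + ℓ)`, so the Beurling–Carleson condition makes `log φ_E` integrable.

On each complementary arc `conj g₁ = 1 / g₁`, and `1 / g₁`, `g₂` and `s` all continue
holomorphically across the arc, `s` with the factor `((1 - conj a * z) (1 - conj b * z)) ^ N` split
off.  Let `d` be the distance from a point of the arc to its endpoints.  On the disc of radius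
`~ d ^ 2` around that point the real part of the kernel `(ζ + z) / (ζ - z)` stays bounded for `ζ`
off the arc, so the continuation of `F` is `O(d ^ N)` there, and Cauchy's estimates give
`F⁽ᵏ⁾ = O(d ^ (N - 2 * k))`.  For `N ≥ 2 * n + 2` and `k ≤ n` this is `O(d ^ 2)`, so every
derivative up to order `n` extends by zero across `E`, with derivative zero there.
-/

namespace BeurlingCarleson

open Metric
open scoped ComplexConjugate

/-! ### The circle measure -/

theorem circleMap_zero_one : circleMap 0 1 = fun t : ℝ => exp (t * I) := by
  ext t
  simp [circleMap]

theorem periodic_comp_exp_mul_I {X : Type*} (f : ℂ → X) :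
    Function.Periodic (fun t : ℝ => f (exp (t * I))) (2 * Real.pi) := by
  have h := (periodic_circleMap 0 1).comp f
  rwa [circleMap_zero_one] at h

theorem ae_circleMeasure_norm_eq_one : ∀ᵐ ζ ∂circleMeasure, ‖ζ‖ = 1 := by
  refine Measure.ae_smul_measure ?_ _
  rw [ae_map_iff (by fun_prop) (measurableSet_eq_fun (by fun_prop) (by fun_prop))]
  exact .of_forall norm_exp_ofReal_mul_I

instance isProbabilityMeasure_circleMeasure : IsProbabilityMeasure circleMeasure := by
  constructor
  rw [circleMeasure, Measure.smul_apply, Measure.map_apply (by fun_prop) MeasurableSet.univ,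
    preimage_univ, Measure.restrict_apply_univ, Real.volume_Ioc, smul_eq_mul,
    show Real.pi - -Real.pi = 2 * Real.pi by ring]
  exact ENNReal.inv_mul_cancel (by simp [Real.pi_pos]) ENNReal.ofReal_ne_top

section

variable {V : Type*} [NormedAddCommGroup V] {f : ℂ → V}

theorem aestronglyMeasurable_map_exp_mul_I (hf : AEStronglyMeasurable f circleMeasure) :
    AEStronglyMeasurable f (Measure.map (fun t : ℝ => exp (t * I))
      (volume.restrict (Ioc (-Real.pi) Real.pi))) :=
  hf.mono_ac (Measure.AbsolutelyContinuous.rfl.smul_right (by simp [ENNReal.mul_eq_top]))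

theorem integral_circleMeasure [NormedSpace ℝ V] (hf : AEStronglyMeasurable f circleMeasure) :
    ∫ ζ, f ζ ∂circleMeasure = Real.circleAverage f 0 1 := by
  have h_shift : Real.circleAverage f 0 1 =
      (2 * Real.pi)⁻¹ • ∫ t in Ioc (-Real.pi) Real.pi, f (exp (t * I)) := by
    rw [Real.circleAverage_def, circleMap_zero_one,
      ← intervalIntegral.integral_of_le (by linarith [Real.pi_pos])]
    have h := (periodic_comp_exp_mul_I f).intervalIntegral_add_eq 0 (-Real.pi)
    rw [zero_add, show -Real.pi + 2 * Real.pi = Real.pi by ring] at h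
    rw [h]
  rw [circleMeasure, integral_smul_measure,
    integral_map (by fun_prop) (aestronglyMeasurable_map_exp_mul_I hf), h_shift,
    ENNReal.toReal_inv, ENNReal.toReal_ofReal (by positivity)]

theorem integrable_circleMeasure_iff (hf : AEStronglyMeasurable f circleMeasure) (a : ℝ) :
    Integrable f circleMeasure ↔
      IntegrableOn (fun t : ℝ => f (exp (t * I))) (Ioc a (a + 2 * Real.pi)) := by
  rw [circleMeasure, integrable_smul_measure (by simp [ENNReal.mul_eq_top]) (by simp [Real.pi_pos]),
    integrable_map_measure (aestronglyMeasurable_map_exp_mul_I hf) (by fun_prop),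
    ← intervalIntegrable_iff_integrableOn_Ioc_of_le (by linarith [Real.pi_pos]),
    ← (periodic_comp_exp_mul_I f).intervalIntegrable_iff (t₁ := -Real.pi),
    show -Real.pi + 2 * Real.pi = Real.pi by ring,
    intervalIntegrable_iff_integrableOn_Ioc_of_le (by linarith [Real.pi_pos])]
  rfl

theorem integrable_circleMeasure_iff_circleIntegrable (hf : AEStronglyMeasurable f circleMeasure) :
    Integrable f circleMeasure ↔ CircleIntegrable f 0 1 := by
  rw [integrable_circleMeasure_iff hf 0, CircleIntegrable, circleMap_zero_one, zero_add,
    intervalIntegrable_iff_integrableOn_Ioc_of_le (by positivity)]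

end

theorem integrable_log_norm_sub (a : ℂ) :
    Integrable (fun ζ : ℂ => Real.log ‖ζ - a‖) circleMeasure :=
  (integrable_circleMeasure_iff_circleIntegrable
    (Measurable.aestronglyMeasurable (by fun_prop))).2 (circleIntegrable_log_norm_sub_const 1)

theorem log_norm_sub_le {a ζ : ℂ} (ha : ‖a‖ = 1) (hζ : ‖ζ‖ = 1) :
    Real.log ‖ζ - a‖ ≤ Real.log 2 := by
  rcases eq_or_ne ‖ζ - a‖ 0 with h | h
  · rw [h, Real.log_zero]
    exact Real.log_nonneg one_le_two
  · refine Real.log_le_log (by positivity) ((norm_sub_le _ _).trans ?_)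
    rw [hζ, ha]
    norm_num

theorem integral_norm_log_norm_sub_le {a : ℂ} (ha : ‖a‖ = 1) :
    ∫ ζ, ‖Real.log ‖ζ - a‖‖ ∂circleMeasure ≤ 2 * Real.log 2 := by
  have h_mean : ∫ ζ, Real.log ‖ζ - a‖ ∂circleMeasure = 0 := by
    rw [integral_circleMeasure (Measurable.aestronglyMeasurable (by fun_prop))]
    exact circleAverage_log_norm_sub_const₁ ha
  have h_pointwise :
      ∀ᵐ ζ ∂circleMeasure, ‖Real.log ‖ζ - a‖‖ ≤ 2 * Real.log 2 - Real.log ‖ζ - a‖ := by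
    filter_upwards [ae_circleMeasure_norm_eq_one] with ζ hζ
    have h_upper := log_norm_sub_le ha hζ
    have h_two : 0 ≤ Real.log 2 := Real.log_nonneg one_le_two
    rw [Real.norm_eq_abs, abs_le]
    constructor <;> linarith
  calc ∫ ζ, ‖Real.log ‖ζ - a‖‖ ∂circleMeasure
      ≤ ∫ ζ, (2 * Real.log 2 - Real.log ‖ζ - a‖) ∂circleMeasure :=
        integral_mono_ae (integrable_log_norm_sub a).norm
          ((integrable_const _).sub (integrable_log_norm_sub a)) h_pointwise
    _ = 2 * Real.log 2 := by
        rw [integral_sub (integrable_const _) (integrable_log_norm_sub a), h_mean]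
        simp

/-! ### Herglotz integrals -/

/-- The Herglotz integral of the measure `v dμ`, where `μ` lives on the unit circle.  The functions
`outerFunction k` and `singularExp E ν` are the exponentials of such integrals. -/
noncomputable def herglotz (μ : Measure ℂ) (v : ℂ → ℝ) (z : ℂ) : ℂ :=
  ∫ ζ, (ζ + z) / (ζ - z) * (v ζ : ℂ) ∂μ

section

variable {μ : Measure ℂ} {v w : ℂ → ℝ} {z z₀ : ℂ} {δ : ℝ}

theorem aestronglyMeasurable_mul_ofReal {k : ℂ → ℂ} (hk : Measurable k)
    (hv : AEStronglyMeasurable v μ) : AEStronglyMeasurable (fun ζ => k ζ * (v ζ : ℂ)) μ :=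
  hk.aestronglyMeasurable.mul (continuous_ofReal.comp_aestronglyMeasurable hv)

theorem integrable_herglotz (hv : Integrable v μ) (hμ : ∀ᵐ ζ ∂μ, ‖ζ‖ = 1) (hδ₀ : 0 < δ)
    (hδ : ∀ᵐ ζ ∂μ, δ ≤ ‖ζ - z‖) :
    Integrable (fun ζ => (ζ + z) / (ζ - z) * (v ζ : ℂ)) μ := by
  refine hv.ofReal.bdd_mul (c := (1 + ‖z‖) / δ)
    (Measurable.aestronglyMeasurable (by fun_prop)) ?_
  filter_upwards [hμ, hδ] with ζ hζ hζδ
  rw [norm_div]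
  gcongr
  exact (norm_add_le _ _).trans_eq (by rw [hζ])

theorem le_norm_sub_of_norm_sub_le {ζ : ℂ} {r : ℝ} (hζ : δ ≤ ‖ζ - z₀‖) (hz : ‖z - z₀‖ ≤ r) :
    δ - r ≤ ‖ζ - z‖ := by
  linarith [norm_sub_le_norm_sub_add_norm_sub ζ z z₀]

theorem hasDerivAt_herglotzKernel (ζ : ℂ) (hz : ζ - z ≠ 0) :
    HasDerivAt (fun z => (ζ + z) / (ζ - z)) (2 * ζ / (ζ - z) ^ 2) z := by
  refine (((hasDerivAt_id' z).const_add ζ).div ((hasDerivAt_id' z).const_sub ζ) hz).congr_deriv ?_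
  ring

theorem differentiableOn_herglotz (hv : Integrable v μ) (hμ : ∀ᵐ ζ ∂μ, ‖ζ‖ = 1)
    (hδ : ∀ᵐ ζ ∂μ, δ ≤ ‖ζ - z₀‖) : DifferentiableOn ℂ (herglotz μ v) (ball z₀ δ) := by
  intro z hz
  rw [mem_ball_iff_norm] at hz
  set c := (δ - ‖z - z₀‖) / 2 with hc
  have hc₀ : 0 < c := by rw [hc]; linarith
  have h_away : ∀ᵐ ζ ∂μ, ∀ x ∈ ball z c, c ≤ ‖ζ - x‖ := by
    filter_upwards [hδ] with ζ hζ x hx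
    have h_dist := le_norm_sub_of_norm_sub_le (le_norm_sub_of_norm_sub_le hζ le_rfl)
      (mem_ball_iff_norm.1 hx).le
    linarith
  refine DifferentiableAt.differentiableWithinAt (hasDerivAt_integral_of_dominated_loc_of_deriv_le
    (F' := fun x ζ => 2 * ζ / (ζ - x) ^ 2 * (v ζ : ℂ)) (bound := fun ζ => 2 / c ^ 2 * ‖v ζ‖)
    (ball_mem_nhds z hc₀) (.of_forall fun x => ?_) ?_ ?_ ?_ ?_ ?_).2.differentiableAt
  · exact aestronglyMeasurable_mul_ofReal (by fun_prop) hv.1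
  · exact integrable_herglotz hv hμ hc₀ (h_away.mono fun ζ hζ => hζ z (mem_ball_self hc₀))
  · exact aestronglyMeasurable_mul_ofReal (by fun_prop) hv.1
  · filter_upwards [hμ, h_away] with ζ hζ hζc x hx
    have h_far := hζc x hx
    rw [norm_mul, norm_real, norm_div, norm_mul, hζ, norm_pow, norm_ofNat, mul_one]
    gcongr
  · exact hv.norm.const_mul _
  · filter_upwards [h_away] with ζ hζc x hx
    exact (hasDerivAt_herglotzKernel ζ (norm_pos_iff.1 (hc₀.trans_le (hζc x hx)))).mul_const _

theorem norm_herglotzKernel_sub_le {ζ : ℂ} (hζ : ‖ζ‖ = 1) (hδ₀ : 0 < δ) (hδ₂ : δ ≤ 2)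
    (hδ : δ ≤ ‖ζ - z₀‖) (hz : ‖z - z₀‖ ≤ δ ^ 2 / 4) :
    ‖(ζ + z) / (ζ - z) - (ζ + z₀) / (ζ - z₀)‖ ≤ 1 := by
  have h_half : δ / 2 ≤ ‖ζ - z‖ := by
    have := le_norm_sub_of_norm_sub_le (r := δ / 2) hδ (hz.trans (by nlinarith))
    linarith
  have hne₀ : ζ - z₀ ≠ 0 := norm_pos_iff.1 (by linarith)
  have hne : ζ - z ≠ 0 := norm_pos_iff.1 (by linarith)
  have h_sub : (ζ + z) / (ζ - z) - (ζ + z₀) / (ζ - z₀) =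
      2 * ζ * (z - z₀) / ((ζ - z) * (ζ - z₀)) := by
    field_simp
    ring
  rw [h_sub, norm_div, norm_mul, norm_mul, norm_mul, hζ, norm_ofNat,
    div_le_one (mul_pos (norm_pos_iff.2 hne) (norm_pos_iff.2 hne₀))]
  nlinarith

theorem norm_herglotz_sub_le (hv : Integrable v μ) (hμ : ∀ᵐ ζ ∂μ, ‖ζ‖ = 1) (hδ₀ : 0 < δ)
    (hδ₂ : δ ≤ 2) (hδ : ∀ᵐ ζ ∂μ, δ ≤ ‖ζ - z₀‖) (hz : ‖z - z₀‖ ≤ δ ^ 2 / 4) :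
    ‖herglotz μ v z - herglotz μ v z₀‖ ≤ ∫ ζ, ‖v ζ‖ ∂μ := by
  have hδz : ∀ᵐ ζ ∂μ, δ / 2 ≤ ‖ζ - z‖ := by
    filter_upwards [hδ] with ζ hζ
    have := le_norm_sub_of_norm_sub_le (r := δ / 2) hζ (hz.trans (by nlinarith))
    linarith
  rw [herglotz, herglotz, ← integral_sub (integrable_herglotz hv hμ (half_pos hδ₀) hδz)
    (integrable_herglotz hv hμ hδ₀ hδ)]
  refine norm_integral_le_of_norm_le hv.norm ?_
  filter_upwards [hμ, hδ] with ζ hζ hζδ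
  rw [← sub_mul, norm_mul, norm_real]
  exact mul_le_of_le_one_left (norm_nonneg _) (norm_herglotzKernel_sub_le hζ hδ₀ hδ₂ hζδ hz)

theorem re_herglotz_eq_zero (hv : Integrable v μ) (hμ : ∀ᵐ ζ ∂μ, ‖ζ‖ = 1) (hδ₀ : 0 < δ)
    (hδ : ∀ᵐ ζ ∂μ, δ ≤ ‖ζ - z₀‖) (hz₀ : ‖z₀‖ = 1) : (herglotz μ v z₀).re = 0 := by
  have h_re : (herglotz μ v z₀).re = ∫ ζ, ((ζ + z₀) / (ζ - z₀) * (v ζ : ℂ)).re ∂μ :=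
    (integral_re (integrable_herglotz hv hμ hδ₀ hδ)).symm
  rw [h_re]
  refine integral_eq_zero_of_ae ?_
  filter_upwards [hμ] with ζ hζ
  have h_poisson := congrFun (poissonKernel_eq_re_herglotzRieszKernel (c := 0) (w := z₀)) ζ
  simp only [poissonKernel_def, Function.comp_apply, herglotzRieszKernel_def, sub_zero, hζ,
    hz₀, sub_self, zero_div] at h_poisson
  rw [re_mul_ofReal, ← h_poisson, zero_mul, Pi.zero_apply]

theorem abs_re_herglotz_le (hv : Integrable v μ) (hμ : ∀ᵐ ζ ∂μ, ‖ζ‖ = 1) (hδ₀ : 0 < δ)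
    (hδ₂ : δ ≤ 2) (hδ : ∀ᵐ ζ ∂μ, δ ≤ ‖ζ - z₀‖) (hz₀ : ‖z₀‖ = 1) (hz : ‖z - z₀‖ ≤ δ ^ 2 / 4) :
    |(herglotz μ v z).re| ≤ ∫ ζ, ‖v ζ‖ ∂μ := by
  have h_sub := (abs_re_le_norm _).trans (norm_herglotz_sub_le hv hμ hδ₀ hδ₂ hδ hz)
  rwa [sub_re, re_herglotz_eq_zero hv hμ hδ₀ hδ hz₀, sub_zero] at h_sub

theorem conj_exp_neg_herglotz (hv : Integrable v μ) (hμ : ∀ᵐ ζ ∂μ, ‖ζ‖ = 1) (hδ₀ : 0 < δ)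
    (hδ : ∀ᵐ ζ ∂μ, δ ≤ ‖ζ - z₀‖) (hz₀ : ‖z₀‖ = 1) :
    conj (exp (-herglotz μ v z₀)) = exp (herglotz μ v z₀) := by
  have h_re := re_herglotz_eq_zero hv hμ hδ₀ hδ hz₀
  rw [← exp_conj]
  congr 1
  apply Complex.ext <;> simp [h_re]

theorem herglotz_zero (hμ : ∀ᵐ ζ ∂μ, ‖ζ‖ = 1) : herglotz μ v 0 = (∫ ζ, v ζ ∂μ : ℝ) := by
  rw [← integral_complex_ofReal, herglotz]
  refine integral_congr_ae ?_
  filter_upwards [hμ] with ζ hζ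
  rw [add_zero, sub_zero, div_self (norm_ne_zero_iff.1 (by rw [hζ]; exact one_ne_zero)), one_mul]

theorem herglotz_add (hv : Integrable v μ) (hw : Integrable w μ) (hμ : ∀ᵐ ζ ∂μ, ‖ζ‖ = 1)
    (hz : z ∈ ball 0 1) :
    herglotz μ (v + w) z = herglotz μ v z + herglotz μ w z := by
  rw [mem_ball_zero_iff] at hz
  have h_away : ∀ᵐ ζ ∂μ, 1 - ‖z‖ ≤ ‖ζ - z‖ := by
    filter_upwards [hμ] with ζ hζ
    exact hζ ▸ norm_sub_norm_le ζ z
  have h_pos : 0 < 1 - ‖z‖ := by linarith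
  rw [herglotz, herglotz, herglotz, ← integral_add (integrable_herglotz hv hμ h_pos h_away)
    (integrable_herglotz hw hμ h_pos h_away)]
  simp only [Pi.add_apply, ofReal_add, mul_add]

end

theorem norm_one_sub_conj_mul {a : ℂ} (ha : ‖a‖ = 1) (z : ℂ) : ‖1 - conj a * z‖ = ‖z - a‖ := by
  have h_unit : conj a * a = 1 := by simp [← normSq_eq_conj_mul_self, normSq_eq_norm_sq, ha]
  rw [← h_unit, ← mul_sub, norm_mul, RCLike.norm_conj, ha, one_mul, norm_sub_rev]

theorem re_herglotz_log_norm_sub {a z : ℂ} (ha : ‖a‖ = 1) (hz : z ∈ ball 0 1) :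
    (herglotz circleMeasure (fun ζ => Real.log ‖ζ - a‖) z).re = Real.log ‖z - a‖ := by
  have h_average : herglotz circleMeasure (fun ζ => Real.log ‖ζ - a‖) z =
      Real.circleAverage (fun ζ => herglotzRieszKernel 0 z ζ • (Real.log ‖ζ - a‖ : ℂ)) 0 1 := by
    rw [herglotz, integral_circleMeasure (Measurable.aestronglyMeasurable (by fun_prop))]
    simp only [herglotzRieszKernel_def, sub_zero, smul_eq_mul]
  rw [h_average, re_circleAverage_herglotzRieszKernel_smul (circleIntegrable_log_norm_sub_const 1)
    hz, smul_eq_mul]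
  exact circleAverage_re_herglotzRieszKernel_mul_log (by simpa using ha) hz

/-- Both sides have modulus `‖z - a‖` on the disc and the value `1` at `0`, so that their quotient
is the constant `1` by the maximum principle. -/
theorem exp_herglotz_log_norm_sub {a z : ℂ} (ha : ‖a‖ = 1) (hz : z ∈ ball 0 1) :
    exp (herglotz circleMeasure (fun ζ => Real.log ‖ζ - a‖) z) = 1 - conj a * z := by
  set H := herglotz circleMeasure fun ζ => Real.log ‖ζ - a‖ with hH
  have h_dist : ∀ w ∈ ball (0 : ℂ) 1, 0 < ‖w - a‖ := by
    rintro w hw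
    refine norm_pos_iff.2 (sub_ne_zero.2 ?_)
    rintro rfl
    exact (mem_ball_zero_iff.1 hw).ne ha
  have hne : ∀ w ∈ ball (0 : ℂ) 1, 1 - conj a * w ≠ 0 := fun w hw =>
    norm_pos_iff.1 ((h_dist w hw).trans_eq (norm_one_sub_conj_mul ha w).symm)
  have h_norm : ∀ w ∈ ball (0 : ℂ) 1, ‖exp (H w) / (1 - conj a * w)‖ = 1 := by
    intro w hw
    rw [norm_div, norm_exp, re_herglotz_log_norm_sub ha hw, Real.exp_log (h_dist w hw),
      norm_one_sub_conj_mul ha, div_self (h_dist w hw).ne']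
  have h_zero : H 0 = 0 := by
    rw [hH, herglotz_zero ae_circleMeasure_norm_eq_one,
      integral_circleMeasure (Measurable.aestronglyMeasurable (by fun_prop)),
      circleAverage_log_norm_sub_const₁ ha, ofReal_zero]
  have h_diff : DifferentiableOn ℂ (fun w => exp (H w) / (1 - conj a * w)) (ball 0 1) := by
    refine DifferentiableOn.div (DifferentiableOn.cexp (differentiableOn_herglotz
      (integrable_log_norm_sub a) ae_circleMeasure_norm_eq_one ?_)) (by fun_prop) hne
    exact ae_circleMeasure_norm_eq_one.mono fun ζ hζ => by rw [sub_zero, hζ]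
  have h_zero_mem : (0 : ℂ) ∈ ball 0 1 := mem_ball_self one_pos
  have h_const := eqOn_of_isPreconnected_of_isMaxOn_norm (convex_ball 0 1).isPreconnected
    isOpen_ball h_diff h_zero_mem
    (fun w hw => ((h_norm w hw).trans (h_norm 0 h_zero_mem).symm).le) hz
  rw [Function.const_apply, h_zero, exp_zero, mul_zero, sub_zero, div_one] at h_const
  exact eq_of_div_eq_one h_const

/-! ### Complementary arcs -/

/-- The set of angles of the points of `E`: the lift of `E` to the universal cover of the circle. -/
def angles (E : Set ℂ) : Set ℝ := {t | exp (t * I) ∈ E}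

/-- `(α, β)` is a bounded component of the complement of `K`.  The gaps of `angles E` are the lifts
of the complementary arcs of `E`. -/
structure IsGap (K : Set ℝ) (α β : ℝ) : Prop where
  lt : α < β
  left_mem : α ∈ K
  right_mem : β ∈ K
  notMem : ∀ t ∈ Ioo α β, t ∉ K

/-- The distance from `t ∈ (α, β)` to the endpoints of the interval. -/
noncomputable def gapDist (α β t : ℝ) : ℝ := min (t - α) (β - t)

section

variable {E : Set ℂ} {K : Set ℝ} {α β α' β' s t : ℝ}

theorem gapDist_le_abs_sub (hs : s ∉ Ioo α β) : gapDist α β t ≤ |s - t| := by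
  contrapose! hs
  obtain ⟨h_left, h_right⟩ := lt_min_iff.1 hs
  exact ⟨by linarith [neg_abs_le (s - t)], by linarith [le_abs_self (s - t)]⟩

theorem gapDist_pos (ht : t ∈ Ioo α β) : 0 < gapDist α β t :=
  lt_min (sub_pos.2 ht.1) (sub_pos.2 ht.2)

theorem two_mul_gapDist_le : 2 * gapDist α β t ≤ β - α := by
  linarith [min_le_left (t - α) (β - t), min_le_right (t - α) (β - t), gapDist.eq_def α β t]

theorem IsGap.eq_of_mem (h : IsGap K α β) (h' : IsGap K α' β') (ht : t ∈ Ioo α β)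
    (ht' : t ∈ Ioo α' β') : α = α' ∧ β = β' := by
  constructor
  · rcases lt_trichotomy α α' with hlt | heq | hlt
    · exact absurd h'.left_mem (h.notMem _ ⟨hlt, ht'.1.trans ht.2⟩)
    · exact heq
    · exact absurd h.left_mem (h'.notMem _ ⟨hlt, ht.1.trans ht'.2⟩)
  · rcases lt_trichotomy β β' with hlt | heq | hlt
    · exact absurd h.right_mem (h'.notMem _ ⟨ht'.1.trans ht.2, hlt⟩)
    · exact heq
    · exact absurd h'.right_mem (h.notMem _ ⟨ht.1.trans ht'.2, hlt⟩)

theorem exists_isGap_of_isClosed (hK : IsClosed K) (hleft : (K ∩ Iic t).Nonempty)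
    (hright : (K ∩ Ici t).Nonempty) (ht : t ∉ K) : ∃ α β, IsGap K α β ∧ t ∈ Ioo α β := by
  obtain ⟨hα, hα_max⟩ := (hK.inter isClosed_Iic).isGreatest_csSup hleft ⟨t, fun _ hx => hx.2⟩
  obtain ⟨hβ, hβ_min⟩ := (hK.inter isClosed_Ici).isLeast_csInf hright ⟨t, fun _ hx => hx.2⟩
  have hαt := lt_of_le_of_ne hα.2 (ne_of_mem_of_not_mem hα.1 ht)
  have htβ := lt_of_le_of_ne hβ.2 (ne_of_mem_of_not_mem hβ.1 ht).symm
  refine ⟨_, _, ⟨hαt.trans htβ, hα.1, hβ.1, fun x hx hxK => ?_⟩, hαt, htβ⟩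
  rcases le_total x t with hxt | hxt
  · exact (hα_max ⟨hxK, hxt⟩).not_gt hx.1
  · exact (hβ_min ⟨hxK, hxt⟩).not_gt hx.2

theorem isClosed_angles (hE : IsClosed E) : IsClosed (angles E) :=
  hE.preimage (by fun_prop)

theorem exp_add_int_mul_two_pi (t : ℝ) (j : ℤ) :
    exp ((t + j * (2 * Real.pi) : ℝ) * I) = exp (t * I) :=
  (periodic_comp_exp_mul_I id).int_mul j t

theorem add_int_mul_two_pi_mem_angles_iff (j : ℤ) :
    t + j * (2 * Real.pi) ∈ angles E ↔ t ∈ angles E := by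
  rw [angles, mem_ofPred_eq, mem_ofPred_eq, exp_add_int_mul_two_pi]

theorem exists_mem_angles_Ico (hne : (angles E).Nonempty) (a : ℝ) :
    ∃ s ∈ Ico a (a + 2 * Real.pi), s ∈ angles E := by
  obtain ⟨s, hs⟩ := hne
  obtain ⟨s', hs', h_eq⟩ :=
    (periodic_comp_exp_mul_I (· ∈ E)).exists_mem_Ico Real.two_pi_pos s a
  exact ⟨s', hs', h_eq.mp hs⟩

theorem exists_isGap (hE : IsClosed E) (hne : (angles E).Nonempty) (ht : t ∉ angles E) :
    ∃ α β, IsGap (angles E) α β ∧ t ∈ Ioo α β := by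
  obtain ⟨l, hl, hlE⟩ := exists_mem_angles_Ico hne (t - 2 * Real.pi)
  obtain ⟨r, hr, hrE⟩ := exists_mem_angles_Ico hne t
  rw [sub_add_cancel] at hl
  exact exists_isGap_of_isClosed (isClosed_angles hE) ⟨l, hlE, hl.2.le⟩ ⟨r, hrE, hr.1⟩ ht

theorem IsGap.add_int_mul_two_pi (h : IsGap (angles E) α β) (j : ℤ) :
    IsGap (angles E) (α + j * (2 * Real.pi)) (β + j * (2 * Real.pi)) where
  lt := by linarith [h.lt]
  left_mem := (add_int_mul_two_pi_mem_angles_iff j).2 h.left_mem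
  right_mem := (add_int_mul_two_pi_mem_angles_iff j).2 h.right_mem
  notMem t ht := by
    have h_shift := h.notMem (t - j * (2 * Real.pi)) ⟨by linarith [ht.1], by linarith [ht.2]⟩
    rwa [← add_int_mul_two_pi_mem_angles_iff j, sub_add_cancel] at h_shift

theorem IsGap.right_le (h : IsGap (angles E) α β) : β ≤ α + 2 * Real.pi := by
  by_contra! hlt
  have h_mem := (h.add_int_mul_two_pi 1).left_mem
  rw [Int.cast_one, one_mul] at h_mem
  exact h.notMem _ ⟨by linarith [Real.pi_pos], hlt⟩ h_mem

theorem IsGap.gapDist_le_pi (h : IsGap (angles E) α β) : gapDist α β t ≤ Real.pi := by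
  linarith [h.right_le, two_mul_gapDist_le (α := α) (β := β) (t := t)]

theorem IsGap.notMem_openArc (h : IsGap (angles E) α β) {ζ : ℂ} (hζ : ζ ∈ E) :
    ζ ∉ openArc (α, β) := by
  rintro ⟨s, hs, rfl⟩
  exact h.notMem s hs hζ

theorem mem_complementaryArcs_iff {p : ℝ × ℝ} :
    p ∈ complementaryArcs E ↔ p.1 ∈ Ico 0 (2 * Real.pi) ∧ IsGap (angles E) p.1 p.2 := by
  have h_disjoint : Disjoint (openArc p) E ↔ ∀ t ∈ Ioo p.1 p.2, t ∉ angles E := by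
    rw [Set.disjoint_left, openArc, forall_mem_image]
    rfl
  constructor
  · rintro ⟨h_nonneg, h_lt, hlt, -, h_arc, h_left, h_right⟩
    exact ⟨⟨h_nonneg, h_lt⟩, hlt, h_left, h_right, h_disjoint.1 h_arc⟩
  · rintro ⟨⟨h_nonneg, h_lt⟩, h⟩
    exact ⟨h_nonneg, h_lt, h.lt, h.right_le, h_disjoint.2 h.notMem, h.left_mem, h.right_mem⟩

theorem IsGap.exists_mem_complementaryArcs (h : IsGap (angles E) α β) :
    ∃ j : ℤ, (α + j * (2 * Real.pi), β + j * (2 * Real.pi)) ∈ complementaryArcs E := by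
  obtain ⟨j, hj, -⟩ := existsUnique_add_zsmul_mem_Ico Real.two_pi_pos α 0
  rw [zsmul_eq_mul, zero_add] at hj
  exact ⟨j, mem_complementaryArcs_iff.2 ⟨hj, h.add_int_mul_two_pi j⟩⟩

theorem phi_exp_of_isGap (h : IsGap (angles E) α β) (ht : t ∈ Ioo α β) :
    phi E (exp (t * I)) = ‖exp (t * I) - exp (α * I)‖ * ‖exp (t * I) - exp (β * I)‖ := by
  have h_exists : ∃ p ∈ complementaryArcs E, exp (t * I) ∈ openArc p := by
    obtain ⟨j, hj⟩ := h.exists_mem_complementaryArcs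
    exact ⟨_, hj, t + j * (2 * Real.pi), by simpa using ht, exp_add_int_mul_two_pi t j⟩
  rw [phi, dif_pos h_exists, norm_mul]
  obtain ⟨hp, s, hs, hst⟩ := h_exists.choose_spec
  obtain ⟨j, rfl⟩ := Circle.exp_eq_exp.1 (Circle.ext hst)
  obtain ⟨h_left, h_right⟩ := (mem_complementaryArcs_iff.1 hp).2.eq_of_mem
    (h.add_int_mul_two_pi j) hs ⟨by linarith [ht.1], by linarith [ht.2]⟩
  rw [h_left, h_right, exp_add_int_mul_two_pi, exp_add_int_mul_two_pi]

theorem phi_of_mem {ζ : ℂ} (h : ζ ∈ E) : phi E ζ = 1 := by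
  rw [phi, dif_neg]
  rintro ⟨p, hp, hζ⟩
  exact (mem_complementaryArcs_iff.1 hp).2.notMem_openArc h hζ

theorem norm_exp_mul_I_sub (s t : ℝ) :
    ‖exp (s * I) - exp (t * I)‖ = 2 * |Real.sin ((s - t) / 2)| := by
  have h : exp (s * I) - exp (t * I) = exp (t * I) * (exp (I * (s - t : ℝ)) - 1) := by
    rw [mul_sub, ← exp_add, mul_one]
    congr 2
    push_cast
    ring
  rw [h, norm_mul, norm_exp_ofReal_mul_I, one_mul, norm_exp_I_mul_ofReal_sub_one, norm_mul,
    Real.norm_eq_abs, Real.norm_eq_abs, abs_two]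

theorem half_abs_sub_le_norm_exp_mul_I_sub (h : |s - t| ≤ Real.pi) :
    |s - t| / 2 ≤ ‖exp (s * I) - exp (t * I)‖ := by
  have h_sin := Real.mul_abs_le_abs_sin (x := (s - t) / 2) (by rw [abs_div, abs_two]; linarith)
  have h_pi : 1 / 2 ≤ 2 / Real.pi := by
    rw [div_le_div_iff₀ two_pos Real.pi_pos]
    linarith [Real.pi_le_four]
  rw [abs_div, abs_two] at h_sin
  rw [norm_exp_mul_I_sub]
  nlinarith [abs_nonneg (s - t)]

theorem half_gapDist_le_norm_sub {ζ : ℂ} (hζ : ‖ζ‖ = 1) (h_arc : ζ ∉ openArc (α, β)) :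
    gapDist α β t / 2 ≤ ‖ζ - exp (t * I)‖ := by
  obtain ⟨θ, rfl⟩ := (norm_eq_one_iff ζ).1 hζ
  obtain ⟨s, hs, h_exp⟩ :=
    (periodic_comp_exp_mul_I id).exists_mem_Ico Real.two_pi_pos θ (t - Real.pi)
  have hsθ : exp (s * I) = exp (θ * I) := h_exp.symm
  have h_near : |s - t| ≤ Real.pi := abs_le.2 ⟨by linarith [hs.1], by linarith [hs.2]⟩
  have h_dist : gapDist α β t ≤ |s - t| :=
    gapDist_le_abs_sub fun hs_mem => h_arc ⟨s, hs_mem, hsθ⟩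
  calc gapDist α β t / 2 ≤ |s - t| / 2 := by gcongr
    _ ≤ ‖exp (θ * I) - exp (t * I)‖ := hsθ ▸ half_abs_sub_le_norm_exp_mul_I_sub h_near

end

/-! ### Integrability of `log φ` -/

section

variable {E : Set ℂ} {α β α₀ s t : ℝ}

theorem IsGap.half_gapDist_le_norm_sub_exp (h : IsGap (angles E) α β) (hs : s ∈ angles E) :
    gapDist α β t / 2 ≤ ‖exp (t * I) - exp (s * I)‖ := by
  rw [norm_sub_rev]
  exact half_gapDist_le_norm_sub (norm_exp_ofReal_mul_I s) (h.notMem_openArc hs)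

theorem norm_exp_mul_I_sub_pos (hs : s ∈ angles E) (ht : t ∉ angles E) :
    0 < ‖exp (t * I) - exp (s * I)‖ := by
  refine norm_pos_iff.2 (sub_ne_zero.2 fun h => ht ?_)
  rwa [angles, mem_ofPred_eq, h]

theorem log_phi_exp_of_isGap (h : IsGap (angles E) α β) (ht : t ∈ Ioo α β) :
    Real.log (phi E (exp (t * I))) =
      Real.log ‖exp (t * I) - exp (α * I)‖ + Real.log ‖exp (t * I) - exp (β * I)‖ := by
  rw [phi_exp_of_isGap h ht,
    Real.log_mul (norm_exp_mul_I_sub_pos h.left_mem (h.notMem t ht)).ne'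
      (norm_exp_mul_I_sub_pos h.right_mem (h.notMem t ht)).ne']

theorem continuousOn_log_phi_exp (hE : IsClosed E) (hne : (angles E).Nonempty) :
    ContinuousOn (fun t : ℝ => Real.log (phi E (exp (t * I)))) (angles E)ᶜ := by
  intro t ht
  obtain ⟨α, β, h, htI⟩ := exists_isGap hE hne ht
  refine ContinuousAt.continuousWithinAt (ContinuousAt.congr (f := fun t : ℝ =>
    Real.log ‖exp (t * I) - exp (α * I)‖ + Real.log ‖exp (t * I) - exp (β * I)‖) ?_ ?_)
  · exact .add (.log (by fun_prop) (norm_exp_mul_I_sub_pos h.left_mem ht).ne')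
      (.log (by fun_prop) (norm_exp_mul_I_sub_pos h.right_mem ht).ne')
  · filter_upwards [Ioo_mem_nhds htI.1 htI.2] with s hs
    exact (log_phi_exp_of_isGap h hs).symm

theorem measurable_log_phi_exp (hE : IsClosed E) (hne : (angles E).Nonempty) :
    Measurable fun t : ℝ => Real.log (phi E (exp (t * I))) := by
  have hK := (isClosed_angles hE).measurableSet
  refine measurable_of_restrict_of_restrict_compl hK ?_
    (continuousOn_iff_continuous_domRestrict.1 (continuousOn_log_phi_exp hE hne)).measurable
  convert measurable_const (a := (0 : ℝ)) using 1
  ext t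
  exact (congrArg Real.log (phi_of_mem t.2)).trans Real.log_one

theorem aestronglyMeasurable_log_phi (hE : IsClosed E) (hne : (angles E).Nonempty) :
    AEStronglyMeasurable (fun ζ => Real.log (phi E ζ)) circleMeasure := by
  refine ⟨_, ((measurable_log_phi_exp hE hne).comp measurable_arg).stronglyMeasurable, ?_⟩
  filter_upwards [ae_circleMeasure_norm_eq_one] with ζ hζ
  have h_arg := norm_mul_exp_arg_mul_I ζ
  rw [hζ, ofReal_one, one_mul] at h_arg
  rw [Function.comp_apply, h_arg]

theorem abs_log_le_of_half_le {c d : ℝ} (hd : 0 < d) (hdc : d / 2 ≤ c) (hc : c ≤ 2) :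
    |Real.log c| ≤ Real.log 2 + |Real.log d| := by
  have h_lower := Real.log_le_log (half_pos hd) hdc
  have h_upper := Real.log_le_log ((half_pos hd).trans_le hdc) hc
  rw [Real.log_div hd.ne' two_ne_zero] at h_lower
  rw [abs_le]
  constructor <;> linarith [neg_abs_le (Real.log d), abs_nonneg (Real.log d)]

theorem IsGap.abs_log_phi_le (h : IsGap (angles E) α β) (ht : t ∈ Ioo α β) :
    |Real.log (phi E (exp (t * I)))| ≤
      2 * Real.log 2 + 2 * (|Real.log (t - α)| + |Real.log (β - t)|) := by
  have h_endpoint : ∀ s ∈ angles E, |Real.log ‖exp (t * I) - exp (s * I)‖| ≤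
      Real.log 2 + |Real.log (gapDist α β t)| := by
    intro s hs
    refine abs_log_le_of_half_le (gapDist_pos ht) (h.half_gapDist_le_norm_sub_exp hs)
      ((norm_sub_le _ _).trans_eq ?_)
    rw [norm_exp_ofReal_mul_I, norm_exp_ofReal_mul_I, one_add_one_eq_two]
  have h_log : |Real.log (gapDist α β t)| ≤ |Real.log (t - α)| + |Real.log (β - t)| := by
    rcases min_choice (t - α) (β - t) with h | h <;> rw [gapDist, h] <;>
      linarith [abs_nonneg (Real.log (t - α)), abs_nonneg (Real.log (β - t))]
  rw [log_phi_exp_of_isGap h ht]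
  refine (abs_add_le _ _).trans ?_
  linarith [h_endpoint α h.left_mem, h_endpoint β h.right_mem]

theorem integral_abs_log_le {L M : ℝ} (hL : 0 ≤ L) (hLM : L ≤ M) (hM : 1 ≤ M) :
    ∫ x in (0 : ℝ)..L, |Real.log x| ≤ (2 * Real.log M + 1) * L + L * Real.log (1 / L) := by
  have h_log : IntervalIntegrable Real.log volume 0 L := intervalIntegral.intervalIntegrable_log'
  calc ∫ x in (0 : ℝ)..L, |Real.log x|
      ≤ ∫ x in (0 : ℝ)..L, (2 * Real.log M - Real.log x) := by
        refine intervalIntegral.integral_mono_on_of_le_Ioo hL h_log.abs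
          (intervalIntegrable_const.sub h_log) fun x hx => ?_
        have h_upper := Real.log_le_log hx.1 (hx.2.le.trans hLM)
        rw [abs_le]
        constructor <;> linarith [Real.log_nonneg hM]
    _ = (2 * Real.log M + 1) * L + L * Real.log (1 / L) := by
        rw [intervalIntegral.integral_sub intervalIntegrable_const h_log, integral_log,
          intervalIntegral.integral_const, one_div, Real.log_inv, smul_eq_mul, zero_mul]
        ring

theorem intervalIntegrable_abs_log_sub (α β : ℝ) :
    IntervalIntegrable (fun t => |Real.log (t - α)|) volume α β ∧
      IntervalIntegrable (fun t => |Real.log (β - t)|) volume α β := by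
  have h_log : IntervalIntegrable (fun x => |Real.log x|) volume 0 (β - α) :=
    intervalIntegral.intervalIntegrable_log'.abs
  exact ⟨by simpa using h_log.comp_sub_right α, by simpa using (h_log.comp_sub_left β).symm⟩

theorem integral_abs_log_sub_add (α β : ℝ) :
    ∫ t in α..β, (|Real.log (t - α)| + |Real.log (β - t)|) =
      2 * ∫ x in (0 : ℝ)..(β - α), |Real.log x| := by
  obtain ⟨h_left, h_right⟩ := intervalIntegrable_abs_log_sub α β
  rw [intervalIntegral.integral_add h_left h_right,
    intervalIntegral.integral_comp_sub_right (fun x => |Real.log x|),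
    intervalIntegral.integral_comp_sub_left (fun x => |Real.log x|), sub_self, sub_self, two_mul]

theorem IsGap.integrableOn_log_phi (hE : IsClosed E) (h : IsGap (angles E) α β) :
    IntegrableOn (fun t : ℝ => Real.log (phi E (exp (t * I)))) (Ioo α β) ∧
      ∫ t in Ioo α β, ‖Real.log (phi E (exp (t * I)))‖ ≤
        (2 * Real.log 2 + 4 * (2 * Real.log (2 * Real.pi) + 1)) * (β - α) +
          4 * ((β - α) * Real.log (1 / (β - α))) := by
  obtain ⟨h_left, h_right⟩ := intervalIntegrable_abs_log_sub α β
  have h_bound := intervalIntegrable_const (c := 2 * Real.log 2).add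
    ((h_left.add h_right).const_mul 2)
  have h_boundOn := (intervalIntegrable_iff_integrableOn_Ioo_of_le h.lt.le).1 h_bound
  have h_le : ∀ᵐ t : ℝ ∂volume.restrict (Ioo α β), ‖Real.log (phi E (exp (t * I)))‖ ≤
      2 * Real.log 2 + 2 * (|Real.log (t - α)| + |Real.log (β - t)|) := by
    filter_upwards [ae_restrict_mem measurableSet_Ioo] with t ht
    exact h.abs_log_phi_le ht
  have h_int := h_boundOn.mono'
    (measurable_log_phi_exp hE ⟨α, h.left_mem⟩).aestronglyMeasurable h_le
  refine ⟨h_int, (integral_mono_ae h_int.norm h_boundOn h_le).trans ?_⟩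
  rw [← integral_Ioc_eq_integral_Ioo, ← intervalIntegral.integral_of_le h.lt.le,
    intervalIntegral.integral_add intervalIntegrable_const ((h_left.add h_right).const_mul 2),
    intervalIntegral.integral_const_mul (2 : ℝ) (fun t => |Real.log (t - α)| + |Real.log (β - t)|),
    integral_abs_log_sub_add, intervalIntegral.integral_const, smul_eq_mul]
  have h_log := integral_abs_log_le (L := β - α) (M := 2 * Real.pi) (by linarith [h.lt])
    (by linarith [h.right_le]) (by linarith [Real.pi_gt_three])
  linarith

theorem pairwiseDisjoint_complementaryArcs :
    (complementaryArcs E).PairwiseDisjoint fun p => Ioo p.1 p.2 := by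
  intro p hp q hq hne
  refine Set.disjoint_left.2 fun t htp htq => hne ?_
  obtain ⟨h_left, h_right⟩ :=
    (mem_complementaryArcs_iff.1 hp).2.eq_of_mem (mem_complementaryArcs_iff.1 hq).2 htp htq
  exact Prod.ext h_left h_right

theorem countable_complementaryArcs : (complementaryArcs E).Countable :=
  pairwiseDisjoint_complementaryArcs.countable_of_isOpen (fun _ _ => isOpen_Ioo)
    fun _ hp => nonempty_Ioo.2 (mem_complementaryArcs_iff.1 hp).2.lt

theorem summable_length_complementaryArcs :
    Summable fun p : complementaryArcs E => p.1.2 - p.1.1 := by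
  have h_subset : ⋃ p ∈ complementaryArcs E, Ioo p.1 p.2 ⊆ Ioo 0 (4 * Real.pi) := by
    refine iUnion₂_subset fun p hp t ht => ?_
    obtain ⟨hpI, h⟩ := mem_complementaryArcs_iff.1 hp
    exact ⟨hpI.1.trans_lt ht.1, by linarith [ht.2, hpI.2, h.right_le]⟩
  have h_finite : ∑' p : complementaryArcs E, volume (Ioo p.1.1 p.1.2) ≠ ⊤ := by
    rw [← measure_biUnion countable_complementaryArcs pairwiseDisjoint_complementaryArcs
      fun _ _ => measurableSet_Ioo]
    exact ((measure_mono h_subset).trans_lt measure_Ioo_lt_top).ne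
  refine (ENNReal.summable_toReal h_finite).congr fun p => ?_
  rw [Real.volume_Ioo,
    ENNReal.toReal_ofReal (by linarith [(mem_complementaryArcs_iff.1 p.2).2.lt])]

theorem exists_isLeast_angles_nonneg (hE : IsClosed E) (hne : (angles E).Nonempty) :
    ∃ α₀, IsLeast (angles E ∩ Ici 0) α₀ := by
  obtain ⟨s, hs, hsE⟩ := exists_mem_angles_Ico hne 0
  exact ⟨_, ((isClosed_angles hE).inter isClosed_Ici).isLeast_csInf ⟨s, hsE, hs.1⟩
    ⟨0, fun _ hx => hx.2⟩⟩

theorem Ico_subset_iUnion_complementaryArcs_union (hE : IsClosed E)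
    (hα₀ : IsLeast (angles E ∩ Ici 0) α₀) :
    Ico α₀ (α₀ + 2 * Real.pi) ⊆ (⋃ p : complementaryArcs E, Ioo p.1.1 p.1.2) ∪ angles E := by
  intro t ht
  by_cases htE : t ∈ angles E
  · exact Or.inr htE
  obtain ⟨⟨hα₀E, hα₀_nonneg⟩, hα₀_min⟩ := hα₀
  obtain ⟨α, β, h, htI⟩ := exists_isGap hE ⟨α₀, hα₀E⟩ htE
  have hα : α₀ ≤ α := by
    by_contra! hlt
    exact h.notMem α₀ ⟨hlt, ht.1.trans_lt htI.2⟩ hα₀E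
  have hα_lt : α < 2 * Real.pi := by
    by_contra! hle
    have h_shift := hα₀_min ⟨(h.add_int_mul_two_pi (-1)).left_mem, by simpa using hle⟩
    rw [Int.cast_neg, Int.cast_one] at h_shift
    linarith [htI.1, ht.2]
  exact Or.inl (mem_iUnion.2
    ⟨⟨(α, β), mem_complementaryArcs_iff.2 ⟨⟨hα₀_nonneg.trans hα, hα_lt⟩, h⟩⟩, htI⟩)

theorem IsBeurlingCarleson.integrable_log_phi (hE : IsBeurlingCarleson E)
    (hne : (angles E).Nonempty) : Integrable (fun ζ => Real.log (phi E ζ)) circleMeasure := by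
  obtain ⟨h_closed, -, h_sum⟩ := hE
  have := countable_complementaryArcs (E := E).to_subtype
  have h_arcs : IntegrableOn (fun t : ℝ => Real.log (phi E (exp (t * I))))
      (⋃ p : complementaryArcs E, Ioo p.1.1 p.1.2) := by
    have h_arc := fun p : complementaryArcs E =>
      (mem_complementaryArcs_iff.1 p.2).2.integrableOn_log_phi h_closed
    refine integrableOn_iUnion_of_summable_integral_norm (fun p => (h_arc p).1) ?_
    exact .of_nonneg_of_le (fun p => integral_nonneg fun _ => norm_nonneg _)
      (fun p => (h_arc p).2) ((summable_length_complementaryArcs.mul_left _).add (h_sum.mul_left 4))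
  have h_angles : IntegrableOn (fun t : ℝ => Real.log (phi E (exp (t * I)))) (angles E) := by
    refine (integrableOn_congr_fun (fun t ht => ?_)
      (isClosed_angles h_closed).measurableSet).2 integrableOn_zero
    rw [phi_of_mem (E := E) ht, Real.log_one]
  obtain ⟨α₀, hα₀⟩ := exists_isLeast_angles_nonneg h_closed hne
  rw [integrable_circleMeasure_iff (aestronglyMeasurable_log_phi h_closed hne) α₀,
    integrableOn_Ioc_iff_integrableOn_Ioo, ← integrableOn_Ico_iff_integrableOn_Ioo]
  exact (h_arcs.union h_angles).mono_set (Ico_subset_iUnion_complementaryArcs_union h_closed hα₀)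

end

/-! ### Smoothness from holomorphic extensions -/

theorem contDiff_of_norm_iteratedDeriv_le {𝕜 V : Type*} [NontriviallyNormedField 𝕜]
    [NormedAddCommGroup V] [NormedSpace 𝕜 V] {K : Set 𝕜} {F : 𝕜 → V} {n : ℕ}
    (h_zero : ∀ t ∈ K, F t = 0)
    (h_diff : ∀ k ≤ n, ∀ t ∉ K, DifferentiableAt 𝕜 (iteratedDeriv k F) t)
    (h_le : ∀ k ≤ n, ∃ C, ∀ t ∉ K, ∀ s ∈ K, ‖iteratedDeriv k F t‖ ≤ C * ‖t - s‖ ^ 2) :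
    ContDiff 𝕜 n F := by
  have h_deriv : ∀ k ≤ n, (∀ t ∈ K, iteratedDeriv k F t = 0) →
      ∀ s ∈ K, HasDerivAt (iteratedDeriv k F) 0 s := by
    intro k hk hk_zero s hs
    obtain ⟨C, hC⟩ := h_le k hk
    have h_isBigO : iteratedDeriv k F =O[𝓝 s] fun t => ‖t - s‖ ^ 2 := by
      refine .of_bound |C| (.of_forall fun t => ?_)
      rw [norm_pow, norm_norm]
      by_cases ht : t ∈ K
      · rw [hk_zero t ht, norm_zero]
        positivity
      · exact (hC t ht s hs).trans (by gcongr; exact le_abs_self C)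
    simpa using (h_isBigO.hasFDerivAt (𝕜 := 𝕜) one_lt_two).hasDerivAt
  have h_iter_zero : ∀ k ≤ n, ∀ t ∈ K, iteratedDeriv k F t = 0 := by
    intro k
    induction k with
    | zero => exact fun _ t ht => by rw [iteratedDeriv_zero, h_zero t ht]
    | succ k ih =>
      intro hk t ht
      rw [iteratedDeriv_succ]
      exact (h_deriv k (by omega) (ih (by omega)) t ht).deriv
  refine contDiff_of_differentiable_iteratedDeriv (n := (n : ℕ∞)) fun k hk t => ?_
  have hkn : k ≤ n := mod_cast hk
  by_cases ht : t ∈ K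
  · exact (h_deriv k hkn (h_iter_zero k hkn) t ht).differentiableAt
  · exact h_diff k hkn t ht

section

variable {V : Type*} [NormedAddCommGroup V] [NormedSpace ℂ V]
  {F : ℝ → V} {G : ℂ → V} {U : Set ℂ} {t : ℝ}

theorem hasDerivAt_of_eqOn_ofReal (hU : IsOpen U) (hG : DifferentiableOn ℂ G U)
    (hFG : ∀ s : ℝ, (s : ℂ) ∈ U → F s = G s) (ht : (t : ℂ) ∈ U) :
    HasDerivAt F (deriv G t) t := by
  have h_comp : HasDerivAt (fun s : ℝ => G s) (deriv G t) t := by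
    simpa [Function.comp_def] using
      ((hG.differentiableAt (hU.mem_nhds ht)).hasDerivAt.scomp t ofRealCLM.hasDerivAt)
  refine h_comp.congr_of_eventuallyEq ?_
  filter_upwards [continuous_ofReal.continuousAt.eventually (hU.mem_nhds ht)] with s hs
  exact hFG s hs

variable [CompleteSpace V]

theorem differentiableOn_iteratedDeriv (hU : IsOpen U) (hG : DifferentiableOn ℂ G U) (k : ℕ) :
    DifferentiableOn ℂ (iteratedDeriv k G) U := by
  induction k with
  | zero => rwa [iteratedDeriv_zero]
  | succ k ih =>
    rw [iteratedDeriv_succ]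
    exact ih.deriv hU

theorem iteratedDeriv_eq_of_eqOn_ofReal (hU : IsOpen U) (hG : DifferentiableOn ℂ G U)
    (hFG : ∀ s : ℝ, (s : ℂ) ∈ U → F s = G s) (k : ℕ) (ht : (t : ℂ) ∈ U) :
    iteratedDeriv k F t = iteratedDeriv k G t := by
  induction k generalizing t with
  | zero => exact hFG t ht
  | succ k ih =>
    rw [iteratedDeriv_succ, iteratedDeriv_succ]
    exact (hasDerivAt_of_eqOn_ofReal hU (differentiableOn_iteratedDeriv hU hG k)
      (fun _ => ih) ht).deriv

theorem norm_iteratedDeriv_le_of_forall_mem_ball {R C : ℝ} {z : ℂ} (hR : 0 < R)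
    (hG : DifferentiableOn ℂ G (ball z R)) (hC : ∀ w ∈ ball z R, ‖G w‖ ≤ C) (k : ℕ) :
    ‖iteratedDeriv k G z‖ ≤ k.factorial * C / (R / 2) ^ k :=
  have h_subset := closedBall_subset_ball (x := z) (half_lt_self hR)
  norm_iteratedDeriv_le_of_forall_mem_sphere_norm_le k (half_pos hR) (hG.diffContOnCl_ball h_subset)
    fun w hw => hC w (h_subset (sphere_subset_closedBall hw))

/-- Cauchy's estimate on a disc of radius `c * d ^ 2` loses the factor `d ^ (2 * k)`, and
`N ≥ 2 * k + 2` leaves a factor `d ^ 2`. -/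
theorem norm_iteratedDeriv_le_of_extension {N k : ℕ} {c d D M r : ℝ} (hk : 2 * k + 2 ≤ N)
    (hc : 0 < c) (hd : d ∈ Ioc 0 D) (hdr : d ≤ r)
    (hG : DifferentiableOn ℂ G (ball t (c * d ^ 2)))
    (hFG : ∀ s : ℝ, (s : ℂ) ∈ ball (t : ℂ) (c * d ^ 2) → F s = G s)
    (hM : ∀ w ∈ ball (t : ℂ) (c * d ^ 2), ‖G w‖ ≤ M * d ^ N) :
    ‖iteratedDeriv k F t‖ ≤ k.factorial * M * (2 / c) ^ k * D ^ (N - 2 * k - 2) * r ^ 2 := by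
  obtain ⟨hd₀, hdD⟩ := hd
  have hD₀ : 0 < D := hd₀.trans_le hdD
  have hR : 0 < c * d ^ 2 := by positivity
  have hM₀ : 0 ≤ M :=
    nonneg_of_mul_nonneg_left ((norm_nonneg _).trans (hM t (mem_ball_self hR))) (pow_pos hd₀ N)
  have h_pow : d ^ N = d ^ (N - 2 * k - 2) * (d ^ 2) ^ k * d ^ 2 := by
    rw [← pow_mul, ← pow_add, ← pow_add]
    congr 1
    omega
  calc ‖iteratedDeriv k F t‖
      ≤ k.factorial * (M * d ^ N) / (c * d ^ 2 / 2) ^ k := by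
        rw [iteratedDeriv_eq_of_eqOn_ofReal isOpen_ball hG hFG k (mem_ball_self hR)]
        exact norm_iteratedDeriv_le_of_forall_mem_ball hR hG hM k
    _ = k.factorial * M * (2 / c) ^ k * d ^ (N - 2 * k - 2) * d ^ 2 := by
        rw [h_pow, div_pow, mul_pow, div_pow]
        field_simp
    _ ≤ k.factorial * M * (2 / c) ^ k * D ^ (N - 2 * k - 2) * r ^ 2 := by gcongr

theorem contDiff_of_holomorphic_extension {K : Set ℝ} {n N : ℕ} {c D M : ℝ}
    (hN : 2 * n + 2 ≤ N) (hc : 0 < c) (h_zero : ∀ t ∈ K, F t = 0)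
    (h_ext : ∀ t ∉ K, ∃ d ∈ Ioc 0 D, (∀ s ∈ K, d ≤ |t - s|) ∧ ∃ G : ℂ → V,
      DifferentiableOn ℂ G (ball t (c * d ^ 2)) ∧
      (∀ s : ℝ, (s : ℂ) ∈ ball (t : ℂ) (c * d ^ 2) → F s = G s) ∧
      ∀ w ∈ ball (t : ℂ) (c * d ^ 2), ‖G w‖ ≤ M * d ^ N) :
    ContDiff ℝ n F := by
  refine contDiff_of_norm_iteratedDeriv_le h_zero (fun k _ t ht => ?_) fun k hk =>
    ⟨k.factorial * M * (2 / c) ^ k * D ^ (N - 2 * k - 2), fun t ht s hs => ?_⟩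
  · obtain ⟨d, ⟨hd₀, -⟩, -, G, hG, hFG, -⟩ := h_ext t ht
    exact (hasDerivAt_of_eqOn_ofReal isOpen_ball (differentiableOn_iteratedDeriv isOpen_ball hG k)
      (fun _ => iteratedDeriv_eq_of_eqOn_ofReal isOpen_ball hG hFG k)
      (mem_ball_self (by positivity))).differentiableAt
  · obtain ⟨d, hd, hdK, G, hG, hFG, hM⟩ := h_ext t ht
    exact norm_iteratedDeriv_le_of_extension (by omega) hc hd (hdK s hs) hG hFG hM

end

/-! ### Continuation across a complementary arc -/

section

variable {E : Set ℂ} {α β s t : ℝ} {z : ℂ}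

theorem norm_exp_mul_I_sub_le {w : ℂ} (hw : ‖w - t‖ ≤ 1) :
    ‖exp (w * I) - exp (t * I)‖ ≤ 2 * ‖w - t‖ := by
  have h_factor : exp (w * I) - exp (t * I) = exp (t * I) * (exp ((w - t) * I) - 1) := by
    rw [mul_sub, ← exp_add, mul_one]
    congr 2
    ring
  have h_norm : ‖(w - t) * I‖ = ‖w - t‖ := by rw [norm_mul, norm_I, mul_one]
  rw [h_factor, norm_mul, norm_exp_ofReal_mul_I, one_mul, ← h_norm]
  exact norm_exp_sub_one_le (h_norm.trans_le hw)

theorem norm_sub_exp_mul_I_le (s t : ℝ) (z : ℂ) :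
    ‖z - exp (s * I)‖ ≤ ‖z - exp (t * I)‖ + min |t - s| 2 := by
  refine (norm_sub_le_norm_sub_add_norm_sub z (exp (t * I)) _).trans ?_
  rw [norm_exp_mul_I_sub]
  gcongr
  refine le_min ?_ ?_
  · have h_sin := Real.abs_sin_le_abs (x := (t - s) / 2)
    rw [abs_div, abs_two] at h_sin
    linarith
  · linarith [Real.abs_sin_le_one ((t - s) / 2)]

theorem norm_sub_exp_mul_norm_sub_exp_le (ht : t ∈ Ioo α β)
    (hz : ‖z - exp (t * I)‖ ≤ min (gapDist α β t) 1) :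
    ‖z - exp (α * I)‖ * ‖z - exp (β * I)‖ ≤ 6 * gapDist α β t := by
  obtain ⟨hz_gap, hz_one⟩ := le_min_iff.1 hz
  have h_far : ∀ s : ℝ, ‖z - exp (s * I)‖ ≤ 3 := fun s => by
    linarith [norm_sub_exp_mul_I_le s t z, min_le_right |t - s| 2]
  have h_near : ∀ s : ℝ, |t - s| = gapDist α β t → ‖z - exp (s * I)‖ ≤ 2 * gapDist α β t :=
    fun s hs => by linarith [norm_sub_exp_mul_I_le s t z, min_le_left |t - s| 2]
  have h_pos := gapDist_pos ht
  rcases min_choice (t - α) (β - t) with h_min | h_min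
  · have hα := h_near α (by rw [abs_of_pos (sub_pos.2 ht.1), gapDist, h_min])
    calc ‖z - exp (α * I)‖ * ‖z - exp (β * I)‖ ≤ 2 * gapDist α β t * 3 := by gcongr; exact h_far β
      _ = 6 * gapDist α β t := by ring
  · have hβ := h_near β (by rw [abs_sub_comm, abs_of_pos (sub_pos.2 ht.2), gapDist, h_min])
    calc ‖z - exp (α * I)‖ * ‖z - exp (β * I)‖ ≤ 3 * (2 * gapDist α β t) := by gcongr; exact h_far α
      _ = 6 * gapDist α β t := by ring

theorem herglotz_restrict_compl_ball {μ : Measure ℂ} {v : ℂ → ℝ} {z₀ : ℂ} {δ : ℝ}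
    (hv : ∀ᵐ ζ ∂μ, ζ ∈ ball z₀ δ → v ζ = 0) :
    herglotz (μ.restrict (ball z₀ δ)ᶜ) v = herglotz μ v := by
  funext z
  refine setIntegral_eq_integral_of_ae_compl_eq_zero ?_
  filter_upwards [hv] with ζ hζ hζ_mem
  rw [hζ (not_not.1 hζ_mem), ofReal_zero, mul_zero]

/-- The logarithm of `φ_E(ζ) / (|ζ - e^{iα}| |ζ - e^{iβ}|)`.  It vanishes on the arc from `e^{iα}`
to `e^{iβ}` if that arc is complementary to `E`, so that its Herglotz integral continues across
it. -/
noncomputable def logRatio (E : Set ℂ) (α β : ℝ) (ζ : ℂ) : ℝ :=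
  Real.log (phi E ζ) - Real.log ‖ζ - exp (α * I)‖ - Real.log ‖ζ - exp (β * I)‖

theorem integrable_logRatio (hφ : Integrable (fun ζ => Real.log (phi E ζ)) circleMeasure) :
    Integrable (logRatio E α β) circleMeasure :=
  (hφ.sub (integrable_log_norm_sub _)).sub (integrable_log_norm_sub _)

theorem integral_norm_logRatio_le (hφ : Integrable (fun ζ => Real.log (phi E ζ)) circleMeasure) :
    ∫ ζ, ‖logRatio E α β ζ‖ ∂circleMeasure ≤
      ∫ ζ, ‖Real.log (phi E ζ)‖ ∂circleMeasure + 4 * Real.log 2 := by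
  have hα := (integrable_log_norm_sub (exp (α * I))).norm
  have hβ := (integrable_log_norm_sub (exp (β * I))).norm
  have hφα : Integrable (fun ζ => ‖Real.log (phi E ζ)‖ + ‖Real.log ‖ζ - exp (α * I)‖‖)
      circleMeasure := hφ.norm.add hα
  calc ∫ ζ, ‖logRatio E α β ζ‖ ∂circleMeasure
      ≤ ∫ ζ, (‖Real.log (phi E ζ)‖ + ‖Real.log ‖ζ - exp (α * I)‖‖ +
          ‖Real.log ‖ζ - exp (β * I)‖‖) ∂circleMeasure :=
        integral_mono (integrable_logRatio hφ).norm (hφα.add hβ) fun ζ =>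
          (norm_sub_le _ _).trans (add_le_add_left (norm_sub_le _ _) _)
    _ ≤ ∫ ζ, ‖Real.log (phi E ζ)‖ ∂circleMeasure + 4 * Real.log 2 := by
        rw [integral_add hφα hβ, integral_add hφ.norm hα]
        linarith [integral_norm_log_norm_sub_le (norm_exp_ofReal_mul_I α),
          integral_norm_log_norm_sub_le (norm_exp_ofReal_mul_I β)]

theorem IsGap.ae_logRatio_eq_zero (h : IsGap (angles E) α β) (t : ℝ) :
    ∀ᵐ ζ ∂circleMeasure, ζ ∈ ball (exp (t * I)) (gapDist α β t / 2) → logRatio E α β ζ = 0 := by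
  filter_upwards [ae_circleMeasure_norm_eq_one] with ζ hζ hζ_near
  rw [mem_ball_iff_norm] at hζ_near
  obtain ⟨s, hs, rfl⟩ : ζ ∈ openArc (α, β) :=
    not_imp_comm.1 (half_gapDist_le_norm_sub hζ) hζ_near.not_ge
  rw [logRatio, log_phi_exp_of_isGap h hs]
  ring

theorem ae_restrict_compl_ball_circleMeasure (z₀ : ℂ) (δ : ℝ) :
    (∀ᵐ ζ ∂circleMeasure.restrict (ball z₀ δ)ᶜ, ‖ζ‖ = 1) ∧
      ∀ᵐ ζ ∂circleMeasure.restrict (ball z₀ δ)ᶜ, δ ≤ ‖ζ - z₀‖ := by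
  refine ⟨ae_restrict_of_ae ae_circleMeasure_norm_eq_one, ?_⟩
  filter_upwards [ae_restrict_mem measurableSet_ball.compl] with ζ hζ
  rwa [mem_compl_iff, mem_ball_iff_norm, not_lt] at hζ

theorem IsGap.differentiableOn_herglotz_logRatio (h : IsGap (angles E) α β)
    (hφ : Integrable (fun ζ => Real.log (phi E ζ)) circleMeasure) (t : ℝ) :
    DifferentiableOn ℂ (herglotz circleMeasure (logRatio E α β))
      (ball (exp (t * I)) (gapDist α β t / 2)) := by
  obtain ⟨h_norm, h_away⟩ :=
    ae_restrict_compl_ball_circleMeasure (exp (t * I)) (gapDist α β t / 2)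
  rw [← herglotz_restrict_compl_ball (h.ae_logRatio_eq_zero t)]
  exact differentiableOn_herglotz (integrable_logRatio hφ).restrict h_norm h_away

theorem IsGap.abs_re_herglotz_logRatio_le (h : IsGap (angles E) α β)
    (hφ : Integrable (fun ζ => Real.log (phi E ζ)) circleMeasure) (ht : t ∈ Ioo α β)
    (hz : ‖z - exp (t * I)‖ ≤ (gapDist α β t / 2) ^ 2 / 4) :
    |(herglotz circleMeasure (logRatio E α β) z).re| ≤
      ∫ ζ, ‖Real.log (phi E ζ)‖ ∂circleMeasure + 4 * Real.log 2 := by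
  obtain ⟨h_norm, h_away⟩ :=
    ae_restrict_compl_ball_circleMeasure (exp (t * I)) (gapDist α β t / 2)
  rw [← herglotz_restrict_compl_ball (h.ae_logRatio_eq_zero t)]
  calc _ ≤ ∫ ζ in (ball (exp (t * I)) (gapDist α β t / 2))ᶜ, ‖logRatio E α β ζ‖ ∂circleMeasure :=
        abs_re_herglotz_le (integrable_logRatio hφ).restrict h_norm (half_pos (gapDist_pos ht))
          (by linarith [h.gapDist_le_pi (t := t), Real.pi_le_four]) h_away
          (norm_exp_ofReal_mul_I t) hz
    _ ≤ ∫ ζ, ‖logRatio E α β ζ‖ ∂circleMeasure :=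
        setIntegral_le_integral (integrable_logRatio hφ).norm (.of_forall fun _ => norm_nonneg _)
    _ ≤ _ := integral_norm_logRatio_le hφ

/-- The continuation of `s` across the complementary arc from `e^{iα}` to `e^{iβ}`, with the zeros
of `s` at the endpoints of the arc split off. -/
noncomputable def outerExtension (E : Set ℂ) (N : ℕ) (α β : ℝ) (z : ℂ) : ℂ :=
  ((1 - conj (exp (α * I)) * z) * (1 - conj (exp (β * I)) * z) *
    exp (herglotz circleMeasure (logRatio E α β) z)) ^ N

theorem outerFunction_eq_outerExtension
    (hφ : Integrable (fun ζ => Real.log (phi E ζ)) circleMeasure) (N : ℕ) (α β : ℝ) :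
    EqOn (outerFunction fun ζ => phi E ζ ^ N) (outerExtension E N α β) (ball 0 1) := by
  intro z hz
  have hα := integrable_log_norm_sub (exp (α * I))
  have hβ := integrable_log_norm_sub (exp (β * I))
  have h_log : (fun ζ => Real.log (phi E ζ)) = (fun ζ => Real.log ‖ζ - exp (α * I)‖) +
      (fun ζ => Real.log ‖ζ - exp (β * I)‖) + logRatio E α β := by
    funext ζ
    rw [Pi.add_apply, Pi.add_apply, logRatio]
    ring
  have h_pow : outerFunction (fun ζ => phi E ζ ^ N) z =
      exp (herglotz circleMeasure (fun ζ => Real.log (phi E ζ)) z) ^ N := by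
    rw [outerFunction, herglotz, ← exp_nat_mul, ← integral_const_mul]
    simp only [Real.log_pow, ofReal_mul, ofReal_natCast, mul_left_comm]
  rw [h_pow, h_log,
    herglotz_add (hα.add hβ) (integrable_logRatio hφ) ae_circleMeasure_norm_eq_one hz,
    herglotz_add hα hβ ae_circleMeasure_norm_eq_one hz, exp_add, exp_add,
    exp_herglotz_log_norm_sub (norm_exp_ofReal_mul_I α) hz,
    exp_herglotz_log_norm_sub (norm_exp_ofReal_mul_I β) hz, outerExtension]

theorem IsGap.differentiableOn_outerExtension (h : IsGap (angles E) α β)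
    (hφ : Integrable (fun ζ => Real.log (phi E ζ)) circleMeasure) (N : ℕ) (t : ℝ) :
    DifferentiableOn ℂ (outerExtension E N α β) (ball (exp (t * I)) (gapDist α β t / 2)) :=
  (DifferentiableOn.mul (by fun_prop) (h.differentiableOn_herglotz_logRatio hφ t).cexp).pow N

theorem IsGap.norm_outerExtension_le (h : IsGap (angles E) α β)
    (hφ : Integrable (fun ζ => Real.log (phi E ζ)) circleMeasure) (N : ℕ) (ht : t ∈ Ioo α β)
    (hz : ‖z - exp (t * I)‖ ≤ (gapDist α β t / 2) ^ 2 / 4) :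
    ‖outerExtension E N α β z‖ ≤
      (6 * Real.exp (∫ ζ, ‖Real.log (phi E ζ)‖ ∂circleMeasure + 4 * Real.log 2)) ^ N *
        gapDist α β t ^ N := by
  have hd₀ := gapDist_pos ht
  have hd₄ : gapDist α β t ≤ 4 := (h.gapDist_le_pi).trans Real.pi_le_four
  have hz_min : ‖z - exp (t * I)‖ ≤ min (gapDist α β t) 1 :=
    le_min (hz.trans (by nlinarith)) (hz.trans (by nlinarith))
  have h_exp : ‖exp (herglotz circleMeasure (logRatio E α β) z)‖ ≤
      Real.exp (∫ ζ, ‖Real.log (phi E ζ)‖ ∂circleMeasure + 4 * Real.log 2) := by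
    rw [norm_exp, Real.exp_le_exp]
    exact (le_abs_self _).trans (h.abs_re_herglotz_logRatio_le hφ ht hz)
  rw [outerExtension, norm_pow, norm_mul, norm_mul,
    norm_one_sub_conj_mul (norm_exp_ofReal_mul_I α),
    norm_one_sub_conj_mul (norm_exp_ofReal_mul_I β), ← mul_pow, mul_right_comm 6]
  exact pow_le_pow_left₀ (by positivity) (mul_le_mul (norm_sub_exp_mul_norm_sub_exp_le ht hz_min)
    h_exp (norm_nonneg _) (by positivity)) N

theorem singularExp_eq_exp_herglotz (E : Set ℂ) (ν : Measure ℂ) :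
    singularExp E ν = fun z => exp (-herglotz (ν.restrict E) (fun _ => 1) z) := by
  funext z
  simp only [singularExp, herglotz, ofReal_one, mul_one]

theorem ae_restrict_norm_eq_one (hE : IsClosed E) (hE_sphere : E ⊆ sphere 0 1) (ν : Measure ℂ) :
    ∀ᵐ ζ ∂ν.restrict E, ‖ζ‖ = 1 := by
  filter_upwards [ae_restrict_mem hE.measurableSet] with ζ hζ
  exact mem_sphere_zero_iff_norm.1 (hE_sphere hζ)

theorem IsGap.ae_restrict_half_gapDist_le (h : IsGap (angles E) α β) (hE : IsClosed E)
    (hE_sphere : E ⊆ sphere 0 1) (ν : Measure ℂ) (t : ℝ) :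
    ∀ᵐ ζ ∂ν.restrict E, gapDist α β t / 2 ≤ ‖ζ - exp (t * I)‖ := by
  filter_upwards [ae_restrict_mem hE.measurableSet] with ζ hζ
  exact half_gapDist_le_norm_sub (mem_sphere_zero_iff_norm.1 (hE_sphere hζ)) (h.notMem_openArc hζ)

theorem IsGap.differentiableOn_herglotz_restrict (h : IsGap (angles E) α β) (hE : IsClosed E)
    (hE_sphere : E ⊆ sphere 0 1) (ν : Measure ℂ) [IsFiniteMeasure ν] (t : ℝ) :
    DifferentiableOn ℂ (herglotz (ν.restrict E) fun _ => 1)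
      (ball (exp (t * I)) (gapDist α β t / 2)) :=
  differentiableOn_herglotz (integrable_const 1) (ae_restrict_norm_eq_one hE hE_sphere ν)
    (h.ae_restrict_half_gapDist_le hE hE_sphere ν t)

theorem IsGap.abs_re_herglotz_restrict_le (h : IsGap (angles E) α β) (hE : IsClosed E)
    (hE_sphere : E ⊆ sphere 0 1) (ν : Measure ℂ) [IsFiniteMeasure ν] (ht : t ∈ Ioo α β)
    (hz : ‖z - exp (t * I)‖ ≤ (gapDist α β t / 2) ^ 2 / 4) :
    |(herglotz (ν.restrict E) (fun _ => 1) z).re| ≤ ν.real E := by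
  refine (abs_re_herglotz_le (integrable_const 1) (ae_restrict_norm_eq_one hE hE_sphere ν)
    (half_pos (gapDist_pos ht)) ?_ (h.ae_restrict_half_gapDist_le hE hE_sphere ν t)
    (norm_exp_ofReal_mul_I t) hz).trans_eq ?_
  · linarith [h.gapDist_le_pi (t := t), Real.pi_le_four]
  · simp only [norm_one, integral_const, measureReal_restrict_apply_univ, smul_eq_mul, mul_one]

/-- The continuation of `conj(g₁) g₂ s` from the complementary arc between `e^{iα}` and `e^{iβ}`.
The exponent of `g₁` changes its sign, being imaginary on the arc. -/
noncomputable def cutoffExtension (E : Set ℂ) (N : ℕ) (ν₁ ν₂ : Measure ℂ) (α β : ℝ) (z : ℂ) : ℂ :=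
  exp (herglotz (ν₁.restrict E) (fun _ => 1) z) * exp (-herglotz (ν₂.restrict E) (fun _ => 1) z) *
    outerExtension E N α β z

section

variable (h : IsGap (angles E) α β) (hE : IsClosed E) (hE_sphere : E ⊆ sphere 0 1)
  (hφ : Integrable (fun ζ => Real.log (phi E ζ)) circleMeasure) (N : ℕ) (ν₁ ν₂ : Measure ℂ)
  [IsFiniteMeasure ν₁] [IsFiniteMeasure ν₂]

include h hE hE_sphere hφ

theorem IsGap.differentiableOn_cutoffExtension (t : ℝ) :
    DifferentiableOn ℂ (cutoffExtension E N ν₁ ν₂ α β)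
      (ball (exp (t * I)) (gapDist α β t / 2)) :=
  ((h.differentiableOn_herglotz_restrict hE hE_sphere ν₁ t).cexp.mul
    (h.differentiableOn_herglotz_restrict hE hE_sphere ν₂ t).neg.cexp).mul
    (h.differentiableOn_outerExtension hφ N t)

theorem IsGap.norm_cutoffExtension_le (ht : t ∈ Ioo α β)
    (hz : ‖z - exp (t * I)‖ ≤ (gapDist α β t / 2) ^ 2 / 4) :
    ‖cutoffExtension E N ν₁ ν₂ α β z‖ ≤
      Real.exp (ν₁.real E) * Real.exp (ν₂.real E) *
        (6 * Real.exp (∫ ζ, ‖Real.log (phi E ζ)‖ ∂circleMeasure + 4 * Real.log 2)) ^ N *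
        gapDist α β t ^ N := by
  have h₁ := (le_abs_self _).trans (h.abs_re_herglotz_restrict_le hE hE_sphere ν₁ ht hz)
  have h₂ := (neg_le_abs _).trans (h.abs_re_herglotz_restrict_le hE hE_sphere ν₂ ht hz)
  rw [cutoffExtension, norm_mul, norm_mul, norm_exp, norm_exp, neg_re,
    mul_assoc (Real.exp _ * Real.exp _)]
  gcongr
  exact h.norm_outerExtension_le hφ N ht hz

end

end

/-! ### Boundary values -/

theorem tendsto_nhdsWithin_of_eqOn {f g : ℂ → ℂ} {U V : Set ℂ} {ζ : ℂ} (hfg : EqOn f g U)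
    (hg : DifferentiableOn ℂ g V) (hV : V ∈ 𝓝 ζ) : Tendsto f (𝓝[U] ζ) (𝓝 (g ζ)) :=
  ((hg.differentiableAt hV).continuousAt.mono_left nhdsWithin_le_nhds).congr'
    (eventually_nhdsWithin_of_forall hfg.symm)

theorem boundaryValue_eq_of_tendsto {f : ℂ → ℂ} {ζ w : ℂ} (hζ : ‖ζ‖ = 1)
    (hf : Tendsto f (𝓝[ball 0 1] ζ) (𝓝 w)) : boundaryValue f ζ = w := by
  have : (𝓝[ball (0 : ℂ) 1] ζ).NeBot := by
    rw [← mem_closure_iff_nhdsWithin_neBot, closure_ball 0 one_ne_zero, mem_closedBall_zero_iff, hζ]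
  exact hf.limUnder_eq

section

variable {E : Set ℂ} {α β t : ℝ}

theorem IsGap.tendsto_singularExp (h : IsGap (angles E) α β) (hE : IsClosed E)
    (hE_sphere : E ⊆ sphere 0 1) (ν : Measure ℂ) [IsFiniteMeasure ν] (ht : t ∈ Ioo α β) :
    Tendsto (singularExp E ν) (𝓝[ball 0 1] exp (t * I))
      (𝓝 (exp (-herglotz (ν.restrict E) (fun _ => 1) (exp (t * I))))) :=
  tendsto_nhdsWithin_of_eqOn (fun z _ => congrFun (singularExp_eq_exp_herglotz E ν) z)
    (h.differentiableOn_herglotz_restrict hE hE_sphere ν t).neg.cexp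
    (ball_mem_nhds _ (half_pos (gapDist_pos ht)))

theorem IsGap.tendsto_outerFunction (h : IsGap (angles E) α β)
    (hφ : Integrable (fun ζ => Real.log (phi E ζ)) circleMeasure) (N : ℕ) (ht : t ∈ Ioo α β) :
    Tendsto (outerFunction fun ζ => phi E ζ ^ N) (𝓝[ball 0 1] exp (t * I))
      (𝓝 (outerExtension E N α β (exp (t * I)))) :=
  tendsto_nhdsWithin_of_eqOn (outerFunction_eq_outerExtension hφ N α β)
    (h.differentiableOn_outerExtension hφ N t) (ball_mem_nhds _ (half_pos (gapDist_pos ht)))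

theorem IsGap.cutoff_exp_eq (h : IsGap (angles E) α β) (hE : IsClosed E)
    (hE_sphere : E ⊆ sphere 0 1) (hφ : Integrable (fun ζ => Real.log (phi E ζ)) circleMeasure)
    (N : ℕ) (ν₁ ν₂ : Measure ℂ) [IsFiniteMeasure ν₁] [IsFiniteMeasure ν₂] (ht : t ∈ Ioo α β) :
    cutoff E (singularExp E ν₁) (singularExp E ν₂) (outerFunction fun ζ => phi E ζ ^ N)
      (exp (t * I)) = cutoffExtension E N ν₁ ν₂ α β (exp (t * I)) := by
  have h_norm := norm_exp_ofReal_mul_I t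
  have h_mem : exp (t * I) ∈ sphere 0 1 \ E := ⟨mem_sphere_zero_iff_norm.2 h_norm, h.notMem t ht⟩
  rw [cutoff, indicator_of_mem h_mem,
    boundaryValue_eq_of_tendsto h_norm (h.tendsto_singularExp hE hE_sphere ν₁ ht),
    boundaryValue_eq_of_tendsto h_norm (h.tendsto_singularExp hE hE_sphere ν₂ ht),
    boundaryValue_eq_of_tendsto h_norm (h.tendsto_outerFunction hφ N ht),
    conj_exp_neg_herglotz (integrable_const 1) (ae_restrict_norm_eq_one hE hE_sphere ν₁)
      (half_pos (gapDist_pos ht)) (h.ae_restrict_half_gapDist_le hE hE_sphere ν₁ t) h_norm,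
    cutoffExtension]

theorem angles_nonempty (hE_sphere : E ⊆ sphere 0 1) (hne : E.Nonempty) : (angles E).Nonempty := by
  obtain ⟨ζ, hζ⟩ := hne
  obtain ⟨t, rfl⟩ := (norm_eq_one_iff ζ).1 (mem_sphere_zero_iff_norm.1 (hE_sphere hζ))
  exact ⟨t, hζ⟩

theorem IsBeurlingCarleson.hasBoundaryValue (hE : IsBeurlingCarleson E) (hne : E.Nonempty) (N : ℕ)
    (ν : Measure ℂ) [IsFiniteMeasure ν] {ζ : ℂ} (hζ : ζ ∈ sphere (0 : ℂ) 1 \ E) :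
    HasBoundaryValue (singularExp E ν) ζ ∧
      HasBoundaryValue (outerFunction fun ζ => phi E ζ ^ N) ζ := by
  obtain ⟨t, rfl⟩ := (norm_eq_one_iff ζ).1 (mem_sphere_zero_iff_norm.1 hζ.1)
  obtain ⟨α, β, h, ht⟩ := exists_isGap hE.1 (angles_nonempty hE.2.1 hne) (t := t) hζ.2
  exact ⟨⟨_, h.tendsto_singularExp hE.1 hE.2.1 ν ht⟩,
    ⟨_, h.tendsto_outerFunction (hE.integrable_log_phi (angles_nonempty hE.2.1 hne)) N ht⟩⟩

theorem IsBeurlingCarleson.contDiff_cutoff (hE : IsBeurlingCarleson E) (hne : E.Nonempty)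
    {n N : ℕ} (hN : 2 * n + 2 ≤ N) (ν₁ ν₂ : Measure ℂ) [IsFiniteMeasure ν₁] [IsFiniteMeasure ν₂] :
    ContDiff ℝ n fun t : ℝ => cutoff E (singularExp E ν₁) (singularExp E ν₂)
      (outerFunction fun ζ => phi E ζ ^ N) (exp (t * I)) := by
  have h_nonempty := angles_nonempty hE.2.1 hne
  have hφ := hE.integrable_log_phi h_nonempty
  obtain ⟨h_closed, h_sphere, -⟩ := hE
  refine contDiff_of_holomorphic_extension (c := 1 / 32) (D := Real.pi) (K := angles E)
    (M := Real.exp (ν₁.real E) * Real.exp (ν₂.real E) *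
      (6 * Real.exp (∫ ζ, ‖Real.log (phi E ζ)‖ ∂circleMeasure + 4 * Real.log 2)) ^ N)
    hN (by norm_num)
    (fun t ht => indicator_of_notMem (fun h => h.2 ht) _) fun t ht => ?_
  obtain ⟨α, β, h, htI⟩ := exists_isGap h_closed h_nonempty ht
  have hd₀ := gapDist_pos htI
  have hd₄ : gapDist α β t ≤ 4 := h.gapDist_le_pi.trans Real.pi_le_four
  have h_near : ∀ w ∈ ball (t : ℂ) (1 / 32 * gapDist α β t ^ 2),
      ‖exp (w * I) - exp (t * I)‖ ≤ (gapDist α β t / 2) ^ 2 / 4 := by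
    intro w hw
    rw [mem_ball_iff_norm] at hw
    exact (norm_exp_mul_I_sub_le (hw.le.trans (by nlinarith))).trans (by linarith)
  refine ⟨gapDist α β t, ⟨hd₀, h.gapDist_le_pi⟩, fun s hs => ?_,
    fun w => cutoffExtension E N ν₁ ν₂ α β (exp (w * I)), ?_, fun s hs => ?_, fun w hw =>
    h.norm_cutoffExtension_le h_closed h_sphere hφ N ν₁ ν₂ htI (h_near w hw)⟩
  · rw [abs_sub_comm]
    exact gapDist_le_abs_sub fun hsI => h.notMem s hsI hs
  · refine (h.differentiableOn_cutoffExtension h_closed h_sphere hφ N ν₁ ν₂ t).comp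
      (Differentiable.differentiableOn (by fun_prop)) fun w hw => ?_
    rw [mem_ball_iff_norm]
    exact (h_near w hw).trans_lt (by nlinarith)
  · rw [mem_ball_iff_norm, ← ofReal_sub, norm_real, Real.norm_eq_abs] at hs
    refine h.cutoff_exp_eq h_closed h_sphere hφ N ν₁ ν₂ (not_not.1 fun hsI => ?_)
    nlinarith [gapDist_le_abs_sub (t := t) hsI]

end

end BeurlingCarleson

theorem mainTheorem11_general {E : Set ℂ} (hE : BeurlingCarleson.IsBeurlingCarleson E)
    (hne : E.Nonempty) :
    Integrable (fun ζ => Real.log (BeurlingCarleson.phi E ζ)) BeurlingCarleson.circleMeasure ∧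
    ∀ n N : ℕ, 2 * n + 2 ≤ N →
      ∀ (ν₁ ν₂ : Measure ℂ) [IsFiniteMeasure ν₁] [IsFiniteMeasure ν₂],
        (∀ ζ ∈ Metric.sphere (0 : ℂ) 1 \ E,
          BeurlingCarleson.HasBoundaryValue (BeurlingCarleson.singularExp E ν₁) ζ ∧
          BeurlingCarleson.HasBoundaryValue (BeurlingCarleson.singularExp E ν₂) ζ ∧
          BeurlingCarleson.HasBoundaryValue
            (BeurlingCarleson.outerFunction fun ζ => BeurlingCarleson.phi E ζ ^ N) ζ) ∧
        ContDiff ℝ n fun t : ℝ =>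
          BeurlingCarleson.cutoff E (BeurlingCarleson.singularExp E ν₁)
            (BeurlingCarleson.singularExp E ν₂)
            (BeurlingCarleson.outerFunction fun ζ => BeurlingCarleson.phi E ζ ^ N)
            (exp (t * I)) := by
  have h_nonempty := BeurlingCarleson.angles_nonempty hE.2.1 hne
  refine ⟨hE.integrable_log_phi h_nonempty, fun n N hN ν₁ ν₂ _ _ =>
    ⟨fun ζ hζ => ?_, hE.contDiff_cutoff hne hN ν₁ ν₂⟩⟩
  exact ⟨(hE.hasBoundaryValue hne N ν₁ hζ).1, hE.hasBoundaryValue hne N ν₂ hζ⟩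

theorem mainTheorem11 :
    (∀ E : Set ℂ, BeurlingCarleson.IsBeurlingCarleson E →
      0 < BeurlingCarleson.circleMeasure E →
      Integrable (fun ζ => Real.log (BeurlingCarleson.phi E ζ)) BeurlingCarleson.circleMeasure) ∧
    ∀ n : ℕ, ∃ N₀ : ℕ, ∀ N : ℕ, N₀ ≤ N →
      ∀ E : Set ℂ, BeurlingCarleson.IsBeurlingCarleson E →
        0 < BeurlingCarleson.circleMeasure E →
      ∀ ν₁ ν₂ : Measure ℂ, IsFiniteMeasure ν₁ → IsFiniteMeasure ν₂ →
        ν₁ Eᶜ = 0 → ν₂ Eᶜ = 0 →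
      ∀ g₁ g₂ s : ℂ → ℂ,
        g₁ = BeurlingCarleson.singularExp E ν₁ →
        g₂ = BeurlingCarleson.singularExp E ν₂ →
        s = BeurlingCarleson.outerFunction (fun ζ => BeurlingCarleson.phi E ζ ^ N) →
        (∀ ζ ∈ Metric.sphere (0 : ℂ) 1 \ E, BeurlingCarleson.HasBoundaryValue g₁ ζ ∧
          BeurlingCarleson.HasBoundaryValue g₂ ζ ∧ BeurlingCarleson.HasBoundaryValue s ζ) ∧
        ContDiff ℝ n
          (fun t : ℝ => BeurlingCarleson.cutoff E g₁ g₂ s (exp (t * I))) := by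
  refine ⟨fun E hE hm => (mainTheorem11_general hE (nonempty_of_measure_ne_zero hm.ne')).1,
    fun n => ⟨2 * n + 2, ?_⟩⟩
  rintro N hN E hE hm ν₁ ν₂ _ _ - - g₁ g₂ s rfl rfl rfl
  exact (mainTheorem11_general hE (nonempty_of_measure_ne_zero hm.ne')).2 n N hN ν₁ ν₂
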